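/- For integers $m\ge 0$ and $k\ge 0$, let $J_{m,k}$ be the number of fixed-point-free involutions $\pi$ of $[m]=\{1,\dots,m\}$ (permutations with $\pi(\pi(i))=i$ and $\pi(i)\neq i$ for all $i\in[m]$) that have exactly $k$ descents, where a descent of $\pi$ is an index $1\le i\le m-1$ with $\pi(i)>\pi(i+1)$. Then for every integer $n\ge 1$ the sequence $J_{2n,1},J_{2n,2},\dots,J_{2n,2n-1}$ is unimodal, that is, there is an index $j$ with $1\le j\le 2n-1$ such that $$J_{2n,1}\le J_{2n,2}\le\cdots\le J_{2n,j}\ge J_{2n,j+1}\ge\cdots\ge J_{2n,2n-1}.$$ -/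

import Mathlib

/-- A permutation `π` of a linearly ordered set of `n` elements, written as the word
`π 0, π 1, …, π (n - 1)`. Its descents are the positions `i` that have a successor `i + 1` and
satisfy `π i > π (i + 1)`. This is the number of descents. -/
def descentNumber {n : ℕ} (π : Equiv.Perm (Fin n)) : ℕ :=
  (Finset.univ.filter fun i : Fin n => ∃ h : (i : ℕ) + 1 < n, π ⟨(i : ℕ) + 1, h⟩ < π i).card

/-- The set of fixed-point-free involutions of an `n`-element linearly ordered set. -/
def fixedPointFreeInvolutions (n : ℕ) : Finset (Equiv.Perm (Fin n)) :=
  Finset.univ.filter fun π => (∀ i, π (π i) = i) ∧ ∀ i, π i ≠ i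

/-- The number `J n k` of fixed-point-free involutions of an `n`-element linearly ordered set
that have exactly `k` descents. -/
def J (n k : ℕ) : ℕ :=
  ((fixedPointFreeInvolutions n).filter fun π => descentNumber π = k).card

/-- The finite sequence `a l, a (l + 1), …, a m` is unimodal: for some index `j` with `l ≤ j ≤ m`,
`a l ≤ a (l + 1) ≤ ⋯ ≤ a j ≥ a (j + 1) ≥ ⋯ ≥ a m`. -/
def IsUnimodalBetween (a : ℕ → ℝ) (l m : ℕ) : Prop :=
  ∃ j : ℕ, l ≤ j ∧ j ≤ m ∧
    (∀ i, l ≤ i → i < j → a i ≤ a (i + 1)) ∧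
    (∀ i, j ≤ i → i < m → a (i + 1) ≤ a i)

/-! Let `a n k` solve the three-term recurrence below. Its coefficients at fixed `n` have a sum
independent of `k`, so summation by parts writes each difference of row `n + 1` through differences
of row `n`. With the symmetry `k ↦ 2n - k`, induction makes row `n` increase up to its centre
(`sub_one_le`, `symm`).

That `a n k = J (2n) k` follows from equal binomial transforms. Both families, summed against
`C(r-k+2n, 2n)`, count multisets of `n` edges of the complete graph on `r + 1` vertices. For `a`,
the recurrence is designed to multiply the transform by `(r(r+1) + 2n) / (2(n+1))`. For `J`, sorting
the `2n` oriented edges lexicographically encodes such a multiset as an involution (edge reversal)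
with a compatible labelling (the initial vertices); an involution with `k` descents has `C(r-k+2n,
2n)` of these. -/

/-- The solution of the three-term recurrence satisfied by the numbers of fixed-point-free involutions of `2 * n`
elements by descents. -/
noncomputable def involutionEulerian : ℕ → ℤ → ℝ
  | 0, k => if k = 0 then 1 else 0
  | n + 1, k => ((k * (k + 1) + 2 * n) * involutionEulerian n k
      + 2 * ((k - 1) * (2 * n + 1 - k) + 1) * involutionEulerian n (k - 1)
      + ((2 * n + 2 - k) * (2 * n + 3 - k) + 2 * n) * involutionEulerian n (k - 2)) / (2 * (n + 1))

/-! ### Symmetry and monotonicity from the recurrence -/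

namespace involutionEulerian

theorem recurrence (n : ℕ) (k : ℤ) :
    2 * ((n : ℝ) + 1) * involutionEulerian (n + 1) k = (k * (k + 1) + 2 * n) * involutionEulerian n k
      + 2 * ((k - 1) * (2 * n + 1 - k) + 1) * involutionEulerian n (k - 1)
      + ((2 * n + 2 - k) * (2 * n + 3 - k) + 2 * n) * involutionEulerian n (k - 2) := by
  rw [involutionEulerian]
  field_simp

theorem eq_zero_of_neg (n : ℕ) {k : ℤ} (hk : k < 0) : involutionEulerian n k = 0 := by
  induction n generalizing k with
  | zero => simp [involutionEulerian, hk.ne]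
  | succ n ih =>
    rw [involutionEulerian, ih hk, ih (by omega), ih (by omega)]
    simp

theorem symm (n : ℕ) (k : ℤ) : involutionEulerian n (2 * n - k) = involutionEulerian n k := by
  induction n generalizing k with
  | zero => simp [involutionEulerian]
  | succ n ih =>
    have h1 := ih k
    have h2 := ih (k - 1)
    have h3 := ih (k - 2)
    have e1 : 2 * ((n + 1 : ℕ) : ℤ) - k = 2 * n - (k - 2) := by push_cast; ring
    have e2 : 2 * (n : ℤ) - (k - 2) - 1 = 2 * n - (k - 1) := by ring
    have e3 : 2 * (n : ℤ) - (k - 2) - 2 = 2 * n - k := by ring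
    rw [e1, involutionEulerian, involutionEulerian, e2, e3, h1, h2, h3]
    push_cast
    ring

theorem sub_one_le (n : ℕ) {k : ℤ} (hk : k ≤ n) :
    involutionEulerian n (k - 1) ≤ involutionEulerian n k := by
  induction n generalizing k with
  | zero =>
    rcases hk.lt_or_eq with h | h
    · rw [eq_zero_of_neg 0 (by push_cast at h; omega), eq_zero_of_neg 0 (by push_cast at h; omega)]
    · simp [involutionEulerian, h]
  | succ n ih =>
    rcases lt_or_ge k 0 with h0 | h0
    · rw [eq_zero_of_neg _ h0, eq_zero_of_neg _ (by omega)]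
    rcases h0.eq_or_lt with h0 | h0
    · subst h0
      have hs := recurrence n 0
      rw [eq_zero_of_neg _ (by omega : (0 : ℤ) - 1 < 0), eq_zero_of_neg _ (by omega : (0 : ℤ) - 2 < 0)] at hs
      rw [eq_zero_of_neg _ (by omega : (0 : ℤ) - 1 < 0)]
      have := ih (k := 0) (by omega)
      rw [eq_zero_of_neg _ (by omega : (0 : ℤ) - 1 < 0)] at this
      push_cast at hs
      by_contra! hneg
      have : 0 ≤ 2 * ((n : ℝ) + 1) * involutionEulerian (n + 1) 0 := by
        rw [hs]; simp; positivity
      nlinarith [(Nat.cast_nonneg n : (0:ℝ) ≤ n)]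
    have hr := recurrence n k
    have hr' := recurrence n (k - 1)
    have e2 : k - 1 - 1 = k - 2 := by ring
    have e3 : k - 1 - 2 = k - 3 := by ring
    rw [e2, e3] at hr'
    have d2 := ih (k := k - 1) (by push_cast at hk; omega)
    have d3 := ih (k := k - 2) (by push_cast at hk; omega)
    rw [e2] at d2
    rw [show k - 2 - 1 = k - 3 by ring] at d3
    have hn : (0 : ℝ) ≤ n := Nat.cast_nonneg n
    have hkR : (1 : ℝ) ≤ k := by exact_mod_cast h0
    have hkn : (k : ℝ) ≤ n + 1 := by exact_mod_cast hk
    set A := involutionEulerian n k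
    set B := involutionEulerian n (k - 1)
    set C := involutionEulerian n (k - 2)
    set D := involutionEulerian n (k - 3)
    -- Summation by parts is exact here because the three coefficients have the same sum for `k` and
    -- `k - 1`.
    have key : 2 * ((n : ℝ) + 1) * (involutionEulerian (n + 1) k - involutionEulerian (n + 1) (k - 1))
        = (k * (k + 1) + 2 * n) * (A - B) + (2 * k + 2 * ((k - 1) * (2 * n + 1 - k) + 1)) * (B - C)
          + ((2 * n + 3 - k) * (2 * n + 4 - k) + 2 * n) * (C - D) := by
      rw [mul_sub, hr, hr']
      push_cast
      ring
    suffices 0 ≤ (k * (k + 1) + 2 * n) * (A - B) + (2 * k + 2 * ((k - 1) * (2 * n + 1 - k) + 1)) * (B - C)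
          + ((2 * n + 3 - k) * (2 * n + 4 - k) + 2 * n) * (C - D) by
      rw [← key] at this
      have := nonneg_of_mul_nonneg_right this (by positivity)
      linarith
    have p3 : 0 ≤ ((2 * n + 3 - k : ℝ) * (2 * n + 4 - k) + 2 * n) * (C - D) :=
      mul_nonneg (add_nonneg (mul_nonneg (by linarith) (by linarith)) (by linarith)) (by linarith)
    rcases (show k ≤ n ∨ k = n + 1 by push_cast at hk; omega) with h | h
    · have d1 := ih h
      have hβ : (0 : ℝ) ≤ (k - 1) * (2 * n + 1 - k) := mul_nonneg (by linarith) (by linarith)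
      have p1 : 0 ≤ (k * (k + 1) + 2 * n : ℝ) * (A - B) := mul_nonneg (by positivity) (by linarith)
      have p2 : 0 ≤ (2 * k + 2 * ((k - 1) * (2 * n + 1 - k) + 1) : ℝ) * (B - C) :=
        mul_nonneg (by linarith) (by linarith)
      linarith
    -- At the new centre `k = n + 1`, symmetry gives `A - B = -(B - C)`, and the net coefficient of
    -- `B - C` is `(n - 1) * (n - 2)`. It is nonnegative only because `n` is an integer.
    · have hA : A = C := by
        have := symm n k
        rw [show 2 * (n : ℤ) - k = k - 2 by omega] at this
        exact this.symm
      have hkR' : (k : ℝ) = n + 1 := by exact_mod_cast h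
      have hq : (0 : ℝ) ≤ (n - 1) * (n - 2) := by
        rcases n with _ | _ | n
        · norm_num
        · norm_num
        · push_cast
          have : (0 : ℝ) ≤ n := Nat.cast_nonneg n
          nlinarith
      have := mul_nonneg hq (sub_nonneg.2 d2)
      rw [hA, hkR'] at *
      nlinarith

end involutionEulerian

/-! ### The binomial transform of the recurrence -/

/-- With `r = x + k` and `m = 2n`, this expands the factor `r(r+1) + 2n` times a degree `m` binomial
in degree `m + 2`; the coefficients are those of the recurrence, each shifted to the index of its
source term. -/
theorem two_term_choose_identity (x k m : ℕ) :
    ((k * (k + 1) + m : ℝ)) * (x + m + 2).choose (m + 2)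
      + 2 * (k * (m - k) + 1) * (x + m + 1).choose (m + 2)
      + ((m - k) * (m - k + 1) + m) * (x + m).choose (m + 2)
    = ((x + k) * (x + k + 1) + m) * (x + m).choose m := by
  have h0 : ((x + m).choose (m + 1) : ℝ) * (m + 1) = (x + m).choose m * x := by
    have := Nat.choose_succ_right_eq (x + m) m
    rw [Nat.add_sub_cancel] at this
    exact_mod_cast this
  have h1 : ((x + m).choose (m + 2) : ℝ) * (m + 2) = (x + m).choose (m + 1) * (x - 1) := by
    have := Nat.choose_succ_right_eq (x + m) (m + 1)
    rcases x with _ | x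
    · simp [Nat.choose_eq_zero_of_lt]
    · rw [show x + 1 + m - (m + 1) = x by omega] at this
      push_cast
      rw [add_sub_cancel_right]
      exact_mod_cast this
  have h2 : ((x + m + 1).choose (m + 2) : ℝ) = (x + m).choose (m + 1) + (x + m).choose (m + 2) := by
    exact_mod_cast Nat.choose_succ_succ (x + m) (m + 1)
  have h3 : ((x + m + 2).choose (m + 2) : ℝ) = (x + m + 1).choose (m + 1) + (x + m + 1).choose (m + 2) := by
    exact_mod_cast Nat.choose_succ_succ (x + m + 1) (m + 1)
  have h4 : ((x + m + 1).choose (m + 1) : ℝ) = (x + m).choose m + (x + m).choose (m + 1) := by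
    exact_mod_cast Nat.choose_succ_succ (x + m) m
  rw [h3, h4, h2]
  have hm1 : (m + 1 : ℝ) ≠ 0 := by positivity
  have hm2 : (m + 2 : ℝ) ≠ 0 := by positivity
  rw [← eq_div_iff hm1] at h0
  rw [← eq_div_iff hm2, h0] at h1
  rw [h1, h0]
  field_simp
  ring

theorem Finset.sum_range_int_sub_one (f : ℤ → ℝ) (N : ℕ) (h0 : f (-1) = 0) (hN : f (N - 1) = 0) :
    ∑ k ∈ Finset.range N, f ((k : ℤ) - 1) = ∑ k ∈ Finset.range N, f k := by
  have : ∀ N : ℕ, ∑ k ∈ Finset.range N, f ((k : ℤ) - 1) + f (N - 1)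
      = ∑ k ∈ Finset.range N, f k + f (-1) := by
    intro N
    induction N with
    | zero => simp
    | succ N ih =>
      rw [Finset.sum_range_succ, Finset.sum_range_succ]
      push_cast
      rw [add_sub_cancel_right]
      linarith
  have := this N
  rwa [h0, hN, add_zero, add_zero] at this

theorem involutionEulerian.sum_mul_choose_succ (n r : ℕ) :
    2 * ((n : ℝ) + 1) * ∑ k ∈ Finset.range (r + 1),
        involutionEulerian (n + 1) k * ((r - k + 2 * (n + 1)).choose (2 * (n + 1)) : ℕ)
      = (r * (r + 1) + 2 * n) * ∑ k ∈ Finset.range (r + 1),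
        involutionEulerian n k * ((r - k + 2 * n).choose (2 * n) : ℕ) := by
  -- The weight vanishes at `k = r + 1` and `k = r + 2`, so shifting the index by one or two loses
  -- no boundary terms.
  let c : ℤ → ℝ := fun k => ((r + 2 * n + 2 - k).toNat.choose (2 * n + 2) : ℕ)
  have c1 : c (r + 1) = 0 := by
    have : ((r : ℤ) + 2 * n + 2 - (r + 1)).toNat = 2 * n + 1 := by omega
    simp only [c, this, Nat.choose_succ_self, Nat.cast_zero]
  have c2 : c (r + 2) = 0 := by
    have : ((r : ℤ) + 2 * n + 2 - (r + 2)).toNat = 2 * n := by omega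
    simp only [c, this, Nat.choose_eq_zero_of_lt (show 2 * n < 2 * n + 2 by omega), Nat.cast_zero]
  have z1 := eq_zero_of_neg n (show (-1 : ℤ) < 0 by norm_num)
  have z2 := eq_zero_of_neg n (show (-2 : ℤ) < 0 by norm_num)
  have s1 : ∑ k ∈ Finset.range (r + 1),
      2 * (((k : ℝ) - 1) * (2 * n + 1 - k) + 1) * involutionEulerian n (k - 1) * c k
      = ∑ k ∈ Finset.range (r + 1), 2 * ((k : ℝ) * (2 * n - k) + 1) * involutionEulerian n k * c (k + 1) := by
    have := Finset.sum_range_int_sub_one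
      (fun k => 2 * ((k : ℝ) * (2 * n - k) + 1) * involutionEulerian n k * c (k + 1)) (r + 1)
      (by simp [z1]) (by push_cast; simp [c1])
    simp only [Int.cast_natCast] at this
    rw [← this]
    refine Finset.sum_congr rfl fun k _ => ?_
    push_cast
    rw [sub_add_cancel]
    ring
  have s2 : ∑ k ∈ Finset.range (r + 1),
      ((2 * (n : ℝ) + 2 - k) * (2 * n + 3 - k) + 2 * n) * involutionEulerian n (k - 2) * c k
      = ∑ k ∈ Finset.range (r + 1),
        ((2 * (n : ℝ) - k) * (2 * n - k + 1) + 2 * n) * involutionEulerian n k * c (k + 2) := by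
    have t1 := Finset.sum_range_int_sub_one
      (fun k => ((2 * (n : ℝ) + 1 - k) * (2 * n + 2 - k) + 2 * n) * involutionEulerian n (k - 1) * c (k + 1)) (r + 1)
      (by simp [z2]) (by push_cast; simp [c1])
    have t2 := Finset.sum_range_int_sub_one
      (fun k => ((2 * (n : ℝ) - k) * (2 * n - k + 1) + 2 * n) * involutionEulerian n k * c (k + 2)) (r + 1)
      (by simp [z1]) (by push_cast; simp [c2])
    simp only [Int.cast_natCast] at t1 t2
    rw [← t2]
    refine Eq.trans ?_ (t1.trans ?_) <;> refine Finset.sum_congr rfl fun k _ => ?_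
    · push_cast
      rw [sub_add_cancel, show (k : ℤ) - 1 - 1 = k - 2 by ring]
      ring
    · push_cast
      rw [show (k : ℤ) - 1 + 2 = k + 1 by ring]
      ring
  have e : ∀ k ∈ Finset.range (r + 1),
      2 * ((n : ℝ) + 1) * (involutionEulerian (n + 1) k * ((r - k + 2 * (n + 1)).choose (2 * (n + 1)) : ℕ))
      = (k * (k + 1) + 2 * n) * involutionEulerian n k * c k
        + 2 * (((k : ℝ) - 1) * (2 * n + 1 - k) + 1) * involutionEulerian n (k - 1) * c k
        + ((2 * (n : ℝ) + 2 - k) * (2 * n + 3 - k) + 2 * n) * involutionEulerian n (k - 2) * c k := by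
    intro k hk
    rw [Finset.mem_range] at hk
    have : c k = ((r - k + 2 * (n + 1)).choose (2 * (n + 1)) : ℕ) := by
      have : ((r : ℤ) + 2 * n + 2 - k).toNat = r - k + 2 * (n + 1) := by omega
      simp only [c, this, mul_add, mul_one]
    rw [← mul_assoc, recurrence, ← this]
    push_cast
    ring
  rw [Finset.mul_sum, Finset.sum_congr rfl e, Finset.sum_add_distrib, Finset.sum_add_distrib, s1, s2,
    ← Finset.sum_add_distrib, ← Finset.sum_add_distrib, Finset.mul_sum]
  refine Finset.sum_congr rfl fun k hk => ?_
  rw [Finset.mem_range] at hk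
  obtain ⟨x, rfl⟩ : ∃ x, r = x + k := ⟨r - k, by omega⟩
  have h := two_term_choose_identity x k (2 * n)
  have e0 : c k = ((x + 2 * n + 2).choose (2 * n + 2) : ℕ) := by
    have : (((x + k : ℕ) : ℤ) + 2 * n + 2 - k).toNat = x + 2 * n + 2 := by omega
    simp only [c, this]
  have e1 : c (k + 1) = ((x + 2 * n + 1).choose (2 * n + 2) : ℕ) := by
    have : (((x + k : ℕ) : ℤ) + 2 * n + 2 - (k + 1)).toNat = x + 2 * n + 1 := by omega
    simp only [c, this]
  have e2 : c (k + 2) = ((x + 2 * n).choose (2 * n + 2) : ℕ) := by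
    have : (((x + k : ℕ) : ℤ) + 2 * n + 2 - (k + 2)).toNat = x + 2 * n := by omega
    simp only [c, this]
  rw [e0, e1, e2, Nat.add_sub_cancel]
  push_cast at h ⊢
  linear_combination involutionEulerian n k * h

theorem involutionEulerian.sum_mul_choose (n r : ℕ) :
    ∑ k ∈ Finset.range (r + 1), involutionEulerian n k * ((r - k + 2 * n).choose (2 * n) : ℕ)
      = (((r + 1).choose 2).multichoose n : ℕ) := by
  induction n with
  | zero => simp [involutionEulerian]
  | succ n ih =>
    have h := involutionEulerian.sum_mul_choose_succ n r
    rw [ih] at h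
    have hN : (((r + 1).choose 2 : ℕ) : ℝ) * 2 = r * (r + 1) := by
      rw [Nat.cast_choose_two]
      push_cast
      ring
    have hm : ((n : ℝ) + 1) * (((r + 1).choose 2).multichoose (n + 1) : ℕ)
        = (((r + 1).choose 2 : ℕ) + n) * (((r + 1).choose 2).multichoose n : ℕ) := by
      -- The value `0` (when `r = 0`) is separate because `Nat.multichoose_eq` has a truncated `-
      -- 1`.
      rcases (r + 1).choose 2 with _ | N
      · rcases n with _ | n <;> simp
      · rw [Nat.multichoose_eq, Nat.multichoose_eq]
        have := Nat.add_one_mul_choose_eq (N + n) n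
        rw [show N + 1 + (n + 1) - 1 = N + n + 1 by omega, show N + 1 + n - 1 = N + n by omega]
        have : ((N + n + 1 : ℕ) : ℝ) * ((N + n).choose n : ℕ) = ((N + n + 1).choose (n + 1) : ℕ) * ((n + 1 : ℕ) : ℝ) := by
          exact_mod_cast this
        push_cast at this ⊢
        linarith
    have hn : (2 * ((n : ℝ) + 1)) ≠ 0 := by positivity
    refine mul_left_cancel₀ hn (h.trans ?_)
    rw [← hN]
    linear_combination -2 * hm

/-! ### Counting labellings compatible with a permutation -/

theorem Fin.card_strictMono (m N : ℕ) :
    (Finset.univ.filter fun g : Fin m → Fin N => StrictMono g).card = N.choose m := by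
  rw [← Finset.card_fin N, ← Finset.card_powersetCard m, Finset.card_fin]
  refine Finset.card_bij' (fun g _ => Finset.univ.image g)
    (fun s hs => s.orderEmbOfFin (Finset.mem_powersetCard.1 hs).2) ?_ ?_ ?_ ?_
  · intro g hg
    rw [Finset.mem_filter] at hg
    simp [Finset.mem_powersetCard, Finset.card_image_of_injective _ hg.2.injective]
  · intro s hs
    simp [OrderEmbedding.strictMono]
  · intro g hg
    rw [Finset.mem_filter] at hg
    symm
    exact Finset.orderEmbOfFin_unique _ (fun i => Finset.mem_image_of_mem _ (Finset.mem_univ _)) hg.2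
  · intro s hs
    ext x
    have := Finset.range_orderEmbOfFin s (Finset.mem_powersetCard.1 hs).2
    rw [← Finset.mem_coe (s := s), ← this]
    simp

/-- Sequences that become strictly increasing after adding a weakly increasing sequence `e` with steps `0` or `1`. -/
theorem Fin.card_add_strictMono (m r : ℕ) (e : Fin (m + 1) → ℕ) (h0 : e 0 = 0) (hmono : Monotone e)
    (hstep : ∀ i : Fin m, e i.succ ≤ e i.castSucc + 1) :
    (Finset.univ.filter fun s : Fin (m + 1) → Fin (r + 1) => StrictMono fun i => (s i : ℕ) + e i).card
      = (r + 1 + e (Fin.last m)).choose (m + 1) := by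
  rw [← Fin.card_strictMono]
  -- Each gap of `g` is at least `1`, hence at least the step of `e`; so the truncated subtraction
  -- `g - e` is genuine.
  have key : ∀ g : Fin (m + 1) → Fin (r + 1 + e (Fin.last m)), StrictMono g →
      (∀ i, e i ≤ g i) ∧ Monotone fun i => (g i : ℕ) - e i := by
    intro g hg
    have hle : ∀ i, e i ≤ g i := by
      intro i
      induction i using Fin.induction with
      | zero => simp [h0]
      | succ i ih =>
        have h1 := hstep i
        have h2 : (g i.castSucc : ℕ) < g i.succ := hg i.castSucc_lt_succ
        omega
    refine ⟨hle, Fin.monotone_iff_le_succ.2 fun i => ?_⟩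
    have h1 := hstep i
    have h2 : (g i.castSucc : ℕ) < g i.succ := hg i.castSucc_lt_succ
    have h3 := hle i.castSucc
    omega
  refine Finset.card_bij'
    (fun s _ i => ⟨s i + e i, by have := hmono (Fin.le_last i); have := (s i).2; omega⟩)
    (fun g hg i => ⟨g i - e i, ?_⟩) ?_ ?_ ?_ ?_
  · obtain ⟨h1, h2⟩ := key g (Finset.mem_filter.1 hg).2
    have h3 := h2 (Fin.le_last i)
    dsimp only at h3
    have := (g (Fin.last m)).2
    omega
  · intro s hs
    exact Finset.mem_filter.2 ⟨Finset.mem_univ _, fun i j hij => (Finset.mem_filter.1 hs).2 hij⟩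
  · intro g hg
    have hg' := (Finset.mem_filter.1 hg).2
    obtain ⟨h1, h2⟩ := key g hg'
    simp only [Finset.mem_filter, Finset.mem_univ, true_and]
    intro i j hij
    have : (g i : ℕ) < g j := hg' hij
    have := h1 i
    have := h1 j
    dsimp only
    omega
  · intro s hs
    ext i
    simp
  · intro g hg
    obtain ⟨h1, h2⟩ := key g (Finset.mem_filter.1 hg).2
    ext i
    simpa using Nat.sub_add_cancel (h1 i)

/-- `s` is weakly increasing, and strictly increasing at the descents of `π`. -/
def DescentCompatible {m : ℕ} {α : Type*} [LinearOrder α] (π : Equiv.Perm (Fin m)) (s : Fin m → α) : Prop :=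
  ∀ i j, i < j → s i < s j ∨ (s i = s j ∧ π i < π j)

/-- The number of ascents of a permutation before the position `i`. -/
def ascentsBefore {m : ℕ} (π : Equiv.Perm (Fin (m + 1))) (i : Fin (m + 1)) : ℕ :=
  (Finset.univ.filter fun j : Fin m => j.castSucc < i ∧ π j.castSucc < π j.succ).card

theorem ascentsBefore_zero {m : ℕ} (π : Equiv.Perm (Fin (m + 1))) : ascentsBefore π 0 = 0 := by
  simp [ascentsBefore]

theorem ascentsBefore_succ {m : ℕ} (π : Equiv.Perm (Fin (m + 1))) (i : Fin m) :
    ascentsBefore π i.succ = ascentsBefore π i.castSucc + if π i.castSucc < π i.succ then 1 else 0 := by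
  unfold ascentsBefore
  have hi : (if π i.castSucc < π i.succ then 1 else 0)
      = (Finset.univ.filter fun j : Fin m => j = i ∧ π j.castSucc < π j.succ).card := by
    split_ifs with h
    · symm
      rw [Finset.card_eq_one]
      refine ⟨i, ?_⟩
      ext j
      simp only [Finset.mem_filter, Finset.mem_univ, true_and, Finset.mem_singleton]
      exact ⟨fun hj => hj.1, fun hj => ⟨hj, hj ▸ h⟩⟩
    · symm
      rw [Finset.card_eq_zero, Finset.filter_eq_empty_iff]
      rintro j - ⟨rfl, hj⟩
      exact h hj
  rw [hi, ← Finset.card_union_of_disjoint]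
  · congr 1
    ext j
    simp only [Finset.mem_filter, Finset.mem_univ, true_and, Finset.mem_union, Fin.castSucc_lt_castSucc_iff,
      Fin.castSucc_lt_succ_iff, le_iff_lt_or_eq]
    tauto
  · rw [Finset.disjoint_filter]
    rintro j - ⟨h1, -⟩ ⟨rfl, -⟩
    exact lt_irrefl _ h1

theorem ascentsBefore_last_add_descentNumber {m : ℕ} (π : Equiv.Perm (Fin (m + 1))) :
    ascentsBefore π (Fin.last m) + descentNumber π = m := by
  have hd : descentNumber π = (Finset.univ.filter fun j : Fin m => ¬ π j.castSucc < π j.succ).card := by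
    unfold descentNumber
    symm
    refine Finset.card_bij (fun j _ => j.castSucc) ?_ ?_ ?_
    · intro j hj
      have h := (Finset.mem_filter.1 hj).2
      simp only [Finset.mem_filter, Finset.mem_univ, true_and]
      exact ⟨by simp, lt_of_le_of_ne (not_lt.1 h) (π.injective.ne (Fin.castSucc_lt_succ (i := j)).ne')⟩
    · intro j _ j' _ h
      exact Fin.castSucc_injective _ h
    · intro i hi
      obtain ⟨h, hlt⟩ := (Finset.mem_filter.1 hi).2
      refine ⟨⟨i, by omega⟩, ?_, rfl⟩
      simp only [Finset.mem_filter, Finset.mem_univ, true_and, not_lt]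
      exact hlt.le
  have ha : ascentsBefore π (Fin.last m)
      = (Finset.univ.filter fun j : Fin m => π j.castSucc < π j.succ).card := by
    simp [ascentsBefore, Fin.castSucc_lt_last]
  rw [hd, ha, Finset.card_filter_add_card_filter_not, Finset.card_univ, Fintype.card_fin]

/-- Compatibility is strict lexicographic increase of `(s i, π i)`, so adjacent positions suffice:
equality of labels is allowed exactly at ascents, where `ascentsBefore` supplies the missing `1`. -/
theorem descentCompatible_iff {m r : ℕ} (π : Equiv.Perm (Fin (m + 1))) (s : Fin (m + 1) → Fin r) :
    DescentCompatible π s ↔ StrictMono fun i => (s i : ℕ) + ascentsBefore π i := by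
  have h : DescentCompatible π s ↔ StrictMono fun i => toLex (s i, π i) := by
    simp only [DescentCompatible, StrictMono, Prod.Lex.toLex_lt_toLex]
  rw [h, Fin.strictMono_iff_lt_succ, Fin.strictMono_iff_lt_succ]
  refine forall_congr' fun i => ?_
  rw [Prod.Lex.toLex_lt_toLex, ascentsBefore_succ]
  dsimp only
  rw [Fin.lt_def (a := s _), Fin.ext_iff (a := s _)]
  split_ifs with h <;> simp only [h, and_true, and_false, or_false] <;> omega

open Classical in
theorem card_descentCompatible {m : ℕ} (r : ℕ) (π : Equiv.Perm (Fin (m + 1))) :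
    (Finset.univ.filter fun s : Fin (m + 1) → Fin (r + 1) => DescentCompatible π s).card
      = (r + 1 + ascentsBefore π (Fin.last m)).choose (m + 1) := by
  simp only [descentCompatible_iff]
  rw [← Fin.card_add_strictMono m r (ascentsBefore π) (ascentsBefore_zero π)]
  · refine Fin.monotone_iff_le_succ.2 fun i => ?_
    rw [ascentsBefore_succ]
    omega
  · intro i
    rw [ascentsBefore_succ]
    split_ifs <;> omega

/-! ### Involutions and multisets of edges -/

theorem Monotone.eq_of_map_univ_eq {m : ℕ} {β : Type*} [LinearOrder β] {w w' : Fin m → β} (hw : Monotone w)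
    (hw' : Monotone w') (h : Finset.univ.val.map w = Finset.univ.val.map w') : w = w' := by
  rw [Fin.univ_val_map, Fin.univ_val_map, Multiset.coe_eq_coe] at h
  exact List.ofFn_injective (h.eq_of_sortedLE hw.sortedLE_ofFn hw'.sortedLE_ofFn)

theorem Multiset.exists_monotone_map_univ_eq {m : ℕ} {β : Type*} [LinearOrder β] (D : Multiset β)
    (hD : Multiset.card D = m) : ∃ w : Fin m → β, Monotone w ∧ Finset.univ.val.map w = D := by
  subst hD
  have hl : (D.sort (· ≤ ·)).length = Multiset.card D := Multiset.length_sort _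
  refine ⟨fun i => (D.sort (· ≤ ·)).get (i.cast hl.symm), ?_, ?_⟩
  · intro i j hij
    exact (Multiset.pairwise_sort D (· ≤ ·)).sortedLE.monotone_get (by simpa using hij)
  · rw [Fin.univ_val_map]
    conv_rhs => rw [← Multiset.sort_eq D (· ≤ ·)]
    congr 1
    apply List.ext_get
    · simp
    · intro i h1 h2
      simp

/-- The two orientations of a multiset of edges. -/
def Multiset.darts {α : Type*} (M : Multiset (α × α)) : Multiset (α × α) :=
  M + M.map Prod.swap

namespace Multiset

variable {α : Type*}

theorem card_darts (M : Multiset (α × α)) : card M.darts = 2 * card M := by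
  simp [darts, two_mul]

theorem map_swap_darts (M : Multiset (α × α)) : M.darts.map Prod.swap = M.darts := by
  simp [darts, add_comm]

theorem filter_darts [LinearOrder α] {M : Multiset (α × α)} (hM : ∀ p ∈ M, p.1 < p.2) :
    M.darts.filter (fun p => p.1 < p.2) = M := by
  rw [darts, filter_add, filter_eq_self.2 hM, filter_eq_nil.2, add_zero]
  intro p hp
  obtain ⟨q, hq, rfl⟩ := mem_map.1 hp
  exact (hM q hq).not_gt

theorem fst_ne_snd_of_mem_darts [LinearOrder α] {M : Multiset (α × α)} (hM : ∀ p ∈ M, p.1 < p.2)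
    {p : α × α} (hp : p ∈ M.darts) : p.1 ≠ p.2 := by
  rcases mem_add.1 hp with hp | hp
  · exact (hM p hp).ne
  · obtain ⟨q, hq, rfl⟩ := mem_map.1 hp
    exact (hM q hq).ne'

end Multiset

namespace DescentCompatible

variable {m : ℕ} {α : Type*} [LinearOrder α] {π : Equiv.Perm (Fin m)} {s : Fin m → α}

theorem monotone (h : DescentCompatible π s) : Monotone s := by
  intro i j hij
  rcases hij.eq_or_lt with rfl | hij
  · exact le_rfl
  · rcases h i j hij with h | h
    · exact h.le
    · exact h.1.le

theorem monotone_toLex (h : DescentCompatible π s) : Monotone fun i => toLex (s i, s (π i)) := by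
  intro i j hij
  rcases hij.eq_or_lt with rfl | hij
  · exact le_rfl
  · rw [Prod.Lex.toLex_le_toLex]
    exact (h i j hij).imp id fun h' => ⟨h'.1, h.monotone h'.2.le⟩

/-- `π` is its own inverse, so it is the stable sort of the end labels `s ∘ π`; the pairs `(s i, s
(π i))` thus determine it. -/
theorem eq_sort (h : DescentCompatible π s) (hπ : ∀ i, π (π i) = i) : π = Tuple.sort (s ∘ π) := by
  rw [Tuple.eq_sort_iff]
  simp only [Function.comp_def, hπ]
  exact ⟨h.monotone, fun i j hij hs => ((h i j hij).resolve_left hs.not_lt).2⟩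

theorem exists_darts_eq (h : DescentCompatible π s) (hπ : ∀ i, π (π i) = i) (hfix : ∀ i, π i ≠ i) :
    ∃ M : Multiset (α × α), (∀ p ∈ M, p.1 < p.2) ∧
      Finset.univ.val.map (fun i => (s i, s (π i))) = M.darts := by
  refine ⟨(Finset.univ.filter fun i => i < π i).val.map fun i => (s i, s (π i)), ?_, ?_⟩
  · intro p hp
    obtain ⟨i, hi, rfl⟩ := Multiset.mem_map.1 hp
    have hi' : i < π i := by simpa using hi
    -- A loop is impossible: equal labels at `i < π i` would force `π i < π (π i) = i`.
    rcases h i _ hi' with h | h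
    · exact h
    · rw [hπ] at h
      exact absurd h.2 hi'.not_gt
  · have hc : (Finset.univ.filter fun i => ¬ i < π i)
        = (Finset.univ.filter fun i => i < π i).map π.toEmbedding := by
      ext i
      simp only [Finset.mem_filter, Finset.mem_univ, true_and, Finset.mem_map, Equiv.coe_toEmbedding, not_lt]
      constructor
      · intro hi
        exact ⟨π i, by rw [hπ]; exact lt_of_le_of_ne hi (hfix i), hπ i⟩
      · rintro ⟨j, hj, rfl⟩
        rw [hπ]
        exact hj.le
    have hu : (Finset.univ : Finset (Fin m)).val
        = (Finset.univ.filter fun i => i < π i).val + (Finset.univ.filter fun i => ¬ i < π i).val := by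
      rw [Finset.filter_val, Finset.filter_val, Multiset.filter_add_not]
    rw [hu, hc, Multiset.map_add, Multiset.darts, Multiset.map_map, Finset.map_val, Multiset.map_map]
    simp only [Function.comp_def, Equiv.coe_toEmbedding, hπ, Prod.swap_prod_mk]

theorem ext_of_map_eq {π' : Equiv.Perm (Fin m)} {s' : Fin m → α} (h : DescentCompatible π s)
    (h' : DescentCompatible π' s') (hπ : ∀ i, π (π i) = i) (hπ' : ∀ i, π' (π' i) = i)
    (he : Finset.univ.val.map (fun i => (s i, s (π i))) = Finset.univ.val.map (fun i => (s' i, s' (π' i)))) :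
    π = π' ∧ s = s' := by
  have hw := Monotone.eq_of_map_univ_eq h.monotone_toLex h'.monotone_toLex
    (by simpa only [Multiset.map_map, Function.comp_def] using congrArg (Multiset.map toLex) he)
  have hw' : ∀ i, s i = s' i ∧ s (π i) = s' (π' i) := fun i =>
    Prod.mk.inj (toLex.injective (congrFun hw i))
  refine ⟨?_, funext fun i => (hw' i).1⟩
  rw [h.eq_sort hπ, h'.eq_sort hπ']
  congr 1
  exact funext fun i => (hw' i).2

end DescentCompatible

/-- List the darts `(s i, t i)` in lexicographic order and let `π` be the stable sort of `t`.
Reversal invariance of the darts makes `π` an involution matching each dart with its reverse;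
without loops it has no fixed point. -/
theorem exists_descentCompatible_of_darts {m : ℕ} {α : Type*} [LinearOrder α] {M : Multiset (α × α)}
    (hM : ∀ p ∈ M, p.1 < p.2) (hcard : Multiset.card M.darts = m) :
    ∃ (π : Equiv.Perm (Fin m)) (s : Fin m → α), (∀ i, π (π i) = i) ∧ (∀ i, π i ≠ i) ∧
      DescentCompatible π s ∧ Finset.univ.val.map (fun i => (s i, s (π i))) = M.darts := by
  obtain ⟨w, hw, hwM⟩ := Multiset.exists_monotone_map_univ_eq (M.darts.map toLex) (by simpa using hcard)
  let s : Fin m → α := fun i => (ofLex (w i)).1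
  let t : Fin m → α := fun i => (ofLex (w i)).2
  have hst : Finset.univ.val.map (fun i => (s i, t i)) = M.darts := by
    have := congrArg (Multiset.map ofLex) hwM
    simpa [Multiset.map_map, Function.comp_def] using this
  have hts : Finset.univ.val.map (fun i => (t i, s i)) = M.darts := by
    rw [← Multiset.map_swap_darts, ← hst, Multiset.map_map]
    rfl
  have hlex : ∀ i j, i < j → s i < s j ∨ (s i = s j ∧ t i ≤ t j) := fun i j hij => by
    have := hw hij.le
    rwa [Prod.Lex.le_iff] at this
  have hs : Monotone s := fun i j hij => by
    rcases hij.eq_or_lt with rfl | hij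
    · exact le_rfl
    · exact (hlex i j hij).elim le_of_lt fun h => h.1.le
  let π := Tuple.sort t
  obtain ⟨htπ, hstable⟩ := Tuple.eq_sort_iff.1 (rfl : π = Tuple.sort t)
  have hperm : ∀ {β : Type _} (f : Fin m → β),
      Finset.univ.val.map (fun i => f (π i)) = Finset.univ.val.map f := fun f => by
    conv_rhs => rw [← Finset.map_univ_equiv π, Finset.map_val, Multiset.map_map]
    rfl
  have h1 : (fun i => t (π i)) = s := by
    refine Monotone.eq_of_map_univ_eq htπ hs ?_
    rw [hperm t]
    have := congrArg (Multiset.map Prod.fst) (hts.trans hst.symm)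
    simpa only [Multiset.map_map, Function.comp_def] using this
  have h1' : ∀ i, t (π i) = s i := congrFun h1
  have hdc : DescentCompatible π s := fun i j hij => by
    rcases (hs hij.le).lt_or_eq with h | h
    · exact Or.inl h
    · refine Or.inr ⟨h, hstable i j hij ?_⟩
      rw [h1', h1', h]
  have h2 : ∀ i, s (π i) = t i := by
    have : (fun i => toLex (s i, s (π i))) = fun i => toLex (s i, t i) := by
      refine Monotone.eq_of_map_univ_eq hdc.monotone_toLex hw ?_
      have h3 : Finset.univ.val.map (fun i => (s i, s (π i))) = M.darts := by
        rw [← hts, ← hperm fun i => (t i, s i)]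
        simp only [h1']
      have := congrArg (Multiset.map toLex) (h3.trans hst.symm)
      simpa only [Multiset.map_map, Function.comp_def] using this
    intro i
    exact (Prod.mk.inj (toLex.injective (congrFun this i))).2
  -- A stable sort is unique, so it suffices that `π.symm` also sorts `t` stably; ties are settled
  -- by the lexicographic order of the darts.
  have hinv : π.symm = π := by
    refine Tuple.eq_sort_iff.2 ⟨?_, fun i j hij hij' => ?_⟩
    · intro i j hij
      simpa [← h2] using hs hij
    · rw [← h2, ← h2, π.apply_symm_apply, π.apply_symm_apply] at hij'
      by_contra hcon
      have hlt : π.symm j < π.symm i := lt_of_le_of_ne (not_lt.1 hcon) (π.symm.injective.ne hij.ne')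
      have e1 := hdc _ _ hlt
      rw [← h1', ← h1' (π.symm i), π.apply_symm_apply, π.apply_symm_apply] at e1
      have e2 := (hlex i j hij).resolve_left hij'.not_lt
      rcases e1 with e1 | e1
      · exact e2.2.not_gt e1
      · exact hij.not_gt e1.2
  have hπ : ∀ i, π (π i) = i := fun i => by
    conv_lhs => enter [2]; rw [← hinv]
    exact π.apply_symm_apply i
  refine ⟨π, s, hπ, fun i hi => ?_, hdc, ?_⟩
  · refine Multiset.fst_ne_snd_of_mem_darts hM (p := (s i, t i)) ?_ ?_
    · rw [← hst]
      exact Multiset.mem_map_of_mem _ (Finset.mem_univ i)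
    · rw [← h2, hi]
  · simp only [h2]
    exact hst

theorem Fin.card_lt_pairs (r : ℕ) : Fintype.card {p : Fin (r + 1) × Fin (r + 1) // p.1 < p.2} = (r + 1).choose 2 := by
  rw [Fintype.card_subtype, Finset.card_filter, ← Finset.univ_product_univ, Finset.sum_product_right]
  have : ∀ j : Fin (r + 1), ∑ i : Fin (r + 1), (if i < j then 1 else 0) = (j : ℕ) := fun j => by
    rw [← Finset.card_filter, ← Fin.card_Iio]
    congr 1
    ext i
    simp
  simp only [this]
  rw [Fin.sum_univ_eq_sum_range (fun j => j), Finset.sum_range_id, Nat.choose_two_right]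

open Classical in
theorem sum_card_descentCompatible (n r : ℕ) :
    ∑ π ∈ fixedPointFreeInvolutions (2 * n),
      (Finset.univ.filter fun s : Fin (2 * n) → Fin (r + 1) => DescentCompatible π s).card
      = ((r + 1).choose 2).multichoose n := by
  rw [← Fin.card_lt_pairs, ← Sym.card_sym_eq_multichoose, ← Finset.card_sigma, ← Finset.card_univ]
  have hval : ∀ M : Sym {p : Fin (r + 1) × Fin (r + 1) // p.1 < p.2} n,
      ∀ p ∈ Multiset.map Subtype.val M.1, p.1 < p.2 := by
    intro M p hp
    obtain ⟨q, -, rfl⟩ := Multiset.mem_map.1 hp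
    exact q.2
  -- The edges are recovered from the darts as those with increasing endpoints.
  have hinj : Function.Injective fun M : Sym {p : Fin (r + 1) × Fin (r + 1) // p.1 < p.2} n =>
      (Multiset.map Subtype.val M.1).darts := by
    intro M M' h
    have h' := congrArg (Multiset.filter fun p => p.1 < p.2) h
    dsimp only at h'
    rw [Multiset.filter_darts (hval M), Multiset.filter_darts (hval M')] at h'
    exact Subtype.ext (Multiset.map_injective Subtype.val_injective h')
  rw [← Finset.card_image_of_injective _ hinj,
    ← Finset.card_image_of_injOn (s := Finset.sigma _ _) (f := fun x : (_ : Equiv.Perm (Fin (2 * n))) × (Fin (2 * n) → Fin (r + 1)) =>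
      Finset.univ.val.map fun i => (x.2 i, x.2 (x.1 i)))]
  · congr 1
    ext D
    simp only [Finset.mem_image, Finset.mem_sigma, Finset.mem_filter, Finset.mem_univ, true_and,
      fixedPointFreeInvolutions]
    constructor
    · rintro ⟨⟨π, s⟩, ⟨⟨hπ, hfix⟩, hs⟩, rfl⟩
      obtain ⟨M, hM, he⟩ := hs.exists_darts_eq hπ hfix
      have hc : Multiset.card M = n := by
        have := congrArg Multiset.card he
        rw [Multiset.card_darts, Multiset.card_map, Finset.card_val, Finset.card_univ, Fintype.card_fin] at this
        omega
      refine ⟨⟨M.attach.map fun p => ⟨p.1, hM _ p.2⟩, by rw [Multiset.card_map, Multiset.card_attach, hc]⟩, ?_⟩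
      refine Eq.trans (congrArg Multiset.darts ?_) he.symm
      change Multiset.map _ (Multiset.map _ _) = _
      rw [Multiset.map_map]
      exact Multiset.attach_map_val M
    · rintro ⟨M, rfl⟩
      obtain ⟨π, s, hπ, hfix, hs, he⟩ := exists_descentCompatible_of_darts (m := 2 * n) (hval M)
        (by simp [Multiset.card_darts])
      exact ⟨⟨π, s⟩, ⟨⟨hπ, hfix⟩, hs⟩, he⟩
  · rintro ⟨π, s⟩ hx ⟨π', s'⟩ hx' h
    simp only [Finset.coe_sigma, Set.mem_sigma_iff, Finset.mem_coe, Finset.mem_filter, Finset.mem_univ, true_and,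
      fixedPointFreeInvolutions] at hx hx'
    obtain ⟨rfl, rfl⟩ := hx.2.ext_of_map_eq hx'.2 hx.1.1 hx'.1.1 h
    rfl

/-! ### Comparison of transforms and conclusion -/

theorem sum_J_mul_choose (n r : ℕ) (hn : 1 ≤ n) :
    ∑ k ∈ Finset.range (r + 1), J (2 * n) k * (r - k + 2 * n).choose (2 * n) = ((r + 1).choose 2).multichoose n := by
  classical
  rw [← sum_card_descentCompatible]
  obtain ⟨m, hm⟩ : ∃ m, 2 * n = m + 1 := ⟨2 * n - 1, by omega⟩
  rw [hm]
  have hc : ∀ π : Equiv.Perm (Fin (m + 1)),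
      (Finset.univ.filter fun s : Fin (m + 1) → Fin (r + 1) => DescentCompatible π s).card
        = ∑ k ∈ Finset.range (r + 1), if descentNumber π = k then (r - k + (m + 1)).choose (m + 1) else 0 := by
    intro π
    have h := ascentsBefore_last_add_descentNumber π
    rw [card_descentCompatible, Finset.sum_ite_eq]
    split_ifs with hk
    · rw [Finset.mem_range] at hk
      congr 1
      omega
    · rw [Finset.mem_range] at hk
      -- More than `r` descents leave no compatible labelling, so the sum may stop at `k = r`.
      exact Nat.choose_eq_zero_of_lt (by omega)
  rw [Finset.sum_congr rfl fun π _ => hc π, Finset.sum_comm]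
  refine Finset.sum_congr rfl fun k _ => ?_
  rw [← Finset.sum_filter, Finset.sum_const, smul_eq_mul, J]

/-- The system is triangular, with diagonal entries `C(m, m) = 1`. -/
theorem eq_of_sum_mul_choose_eq {m : ℕ} {x y : ℕ → ℝ}
    (h : ∀ r : ℕ, ∑ k ∈ Finset.range (r + 1), x k * ((r - k + m).choose m : ℕ)
      = ∑ k ∈ Finset.range (r + 1), y k * ((r - k + m).choose m : ℕ)) (r : ℕ) : x r = y r := by
  induction r using Nat.strong_induction_on with
  | _ r ih =>
    have hr := h r
    rw [Finset.sum_range_succ, Finset.sum_range_succ,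
      Finset.sum_congr rfl fun k hk => by rw [ih k (Finset.mem_range.1 hk)]] at hr
    simpa using hr

theorem J_eq_involutionEulerian (n k : ℕ) (hn : 1 ≤ n) : (J (2 * n) k : ℝ) = involutionEulerian n k := by
  refine eq_of_sum_mul_choose_eq (m := 2 * n) (x := fun k => (J (2 * n) k : ℝ))
    (y := fun k => involutionEulerian n k) (fun r => ?_) k
  rw [involutionEulerian.sum_mul_choose, ← sum_J_mul_choose n r hn]
  push_cast
  rfl

theorem mainTheorem2 (n : ℕ) (hn : 1 ≤ n) :
    IsUnimodalBetween (fun k => (J (2 * n) k : ℝ)) 1 (2 * n - 1) := by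
  -- The peak is the centre of symmetry; the descending half reflects the ascending one.
  refine ⟨n, hn, by omega, fun i _ hi => ?_, fun i hi _ => ?_⟩
  · simp only [J_eq_involutionEulerian n _ hn]
    have := involutionEulerian.sub_one_le n (k := (i + 1 : ℕ)) (by exact_mod_cast hi)
    simpa using this
  · simp only [J_eq_involutionEulerian n _ hn]
    have := involutionEulerian.sub_one_le n (k := 2 * n - i) (by omega)
    rw [involutionEulerian.symm, show 2 * (n : ℤ) - i - 1 = 2 * n - (i + 1 : ℕ) by push_cast; ring,
      involutionEulerian.symm] at this
    exact this
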